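/- Let $r$ be a positive integer and let $\nu_1,\dots,\nu_r$ be probability distributions on $\mathbb R$, each of them non-degenerate (that is, not concentrated at a single point). Let $\eta_0,\eta_1,\eta_2,\dots$ be independent real-valued random variables on a probability space $(\Omega,\mathcal F,\mathbb P)$ such that the distribution of each $\eta_k$ is one of $\nu_1,\dots,\nu_r$. For $n\ge 0$ put $g_n(x)=\sum_{k=0}^{n}\eta_k x^k$, and let $M_n$ be the number of real roots of the polynomial $g_n$, counted with multiplicity, with $M_n=0$ on the event that $g_n$ is the zero polynomial. Then almost surely $g_n$ is a nonzero polynomial for all sufficiently large $n$, each $M_n$ is an integrable random variable, and $$\mathbb P\Big\{\frac{M_n}{n}\xrightarrow[n\to\infty]{}0\Big\}=1,\qquad \mathbb E M_n=o(n),\quad n\to\infty.$$ -/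

import Mathlib

open MeasureTheory ProbabilityTheory Filter Topology Asymptotics

/-- A probability distribution on the real line is degenerate if it is concentrated at one point,
and non-degenerate otherwise. -/
def NondegenerateLaw (ν : Measure ℝ) : Prop :=
  ∀ a : ℝ, ν ≠ Measure.dirac a

/-- The random polynomial `g_n(x) = ∑_{k = 0}^{n} η_k x^k`, at the sample point `ω`. -/
noncomputable def randomPoly {Ω : Type*} (η : ℕ → Ω → ℝ) (n : ℕ) (ω : Ω) : Polynomial ℝ :=
  ∑ k ∈ Finset.range (n + 1), Polynomial.C (η k ω) * Polynomial.X ^ k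

/-- The number `M_n` of real roots of `g_n`, counted with multiplicity. At the sample points where
`g_n` is the zero polynomial the value is `0`, by convention. -/
noncomputable def numRealRoots {Ω : Type*} (η : ℕ → Ω → ℝ) (n : ℕ) (ω : Ω) : ℕ :=
  Multiset.card (randomPoly η n ω).roots

/-!
The proof is elementary: it rests on Rolle's theorem and a Chebyshev polynomial.

Let `θ = X · d/dX` be the Euler operator (`eulerOp`). Rolle's theorem, applied to
`|x|^(-s) f(x)`, shows that passing from `f` to `θ f - s f` loses at most one zero in an interval
that misses the origin. Hence, if `Q` has only real zeros, multiplying each coefficient `f_k` by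
`Q(k)` loses at most `deg Q` zeros (`countP_roots_le_aeval_eulerOp`). A zero of `Q` at `k` removes
the coefficient `f_k`, whatever its size, at the price of one zero; this disposes of arbitrarily
heavy tails.

Suppose that all but a small proportion of the coefficients `f_0, …, f_n` are bounded by `A`, and
that some `f_m` with `m` close to `0` has modulus at least `a`. Take for `Q` the product of the
factors `X - s`, with `s` ranging over the exceptional indices, the indices below `m` and a short
block above `m`, and of a Chebyshev polynomial which is bounded by `1` on the remaining indices and
exponentially large at `m`. All the degrees are small proportions of `n`, and the coefficient of
`X ^ m` in `Q(θ) f` dominates the others, so that `Q(θ) f` has no zero with `0 < |x| ≤ 1`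
(`exists_multiplier`, `countP_roots_le_natDegree_of_dominant`). The zeros with `|x| ≥ 1` are treated
in the same way, with `m` close to `n`. The outcome is the deterministic bound
`eventually_card_roots_le`: a proportion `τ ^ 4` of exceptional coefficients leaves at most
`80 τ n` real zeros.

The hypotheses of this bound hold almost surely for large `n`. Finitely many laws form a tight
family, and none of them is the point mass at `0`; union bounds over index sets and the
Borel–Cantelli lemma then give the required coefficients. The statement about expectations follows
by dominated convergence, since `M_n ≤ n`. Measurability of `M_n` holds because the polynomials of
degree at most `n` that are products of `m` linear factors and a cofactor form a continuous image of
a `σ`-compact space (`measurable_numRealRoots`).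
-/

/-! ### Rolle's theorem for the Euler operator -/

section EulerOperator

open Polynomial

/-- The Euler operator `θ = X · d/dX` on real polynomials. It multiplies the `k`-th coefficient
by `k`. -/
noncomputable def eulerOp : Module.End ℝ ℝ[X] :=
  LinearMap.mulLeft ℝ X ∘ₗ Polynomial.derivative

lemma eulerOp_apply (f : ℝ[X]) : eulerOp f = X * derivative f := rfl

lemma coeff_eulerOp (f : ℝ[X]) (k : ℕ) : (eulerOp f).coeff k = k * f.coeff k := by
  rw [eulerOp_apply]
  cases k with
  | zero => simp
  | succ k => rw [coeff_X_mul, coeff_derivative]; push_cast; ring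

/-- Applying the polynomial `Q` to the Euler operator multiplies the `k`-th coefficient by
`Q(k)`. -/
lemma coeff_aeval_eulerOp (Q f : ℝ[X]) (k : ℕ) :
    (aeval eulerOp Q f).coeff k = Q.eval (k : ℝ) * f.coeff k := by
  induction Q using Polynomial.induction_on' generalizing f with
  | add p q hp hq => simp [hp, hq, add_mul]
  | monomial m a =>
    rw [aeval_monomial, eval_monomial]
    have h : ∀ m : ℕ, ((eulerOp ^ m) f).coeff k = (k : ℝ) ^ m * f.coeff k := by
      intro m
      induction m with
      | zero => simp
      | succ m ih => rw [pow_succ', Module.End.mul_apply, coeff_eulerOp, ih]; ring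
    simp [h, mul_assoc]

/-- Between two consecutive zeros of `f` on the same side of the origin there is a zero of
`θ f - s f`, because `|x|^(-s) f(x)` has a critical point there. -/
lemma exists_isRoot_eulerOp_sub {f : ℝ[X]} (s : ℝ) {x y : ℝ} (hxy : x < y)
    (h0 : (0 : ℝ) ∉ Set.Icc x y) (hx : f.eval x = 0) (hy : f.eval y = 0) :
    ∃ z ∈ Set.Ioo x y, (eulerOp f - C s * f).eval z = 0 := by
  have hne : ∀ z ∈ Set.Icc x y, z ≠ 0 := fun z hz h => h0 (h ▸ hz)
  have hd : ∀ z ∈ Set.Icc x y, HasDerivAt (fun u => Real.exp (-s * Real.log u) * f.eval u)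
      (Real.exp (-s * Real.log z) * (-s * z⁻¹) * f.eval z
        + Real.exp (-s * Real.log z) * (derivative f).eval z) z := fun z hz =>
    (((Real.hasDerivAt_log (hne z hz)).const_mul (-s)).exp).mul (f.hasDerivAt z)
  obtain ⟨z, hz, hz'⟩ := exists_hasDerivAt_eq_zero hxy
    (fun z hz => (hd z hz).continuousAt.continuousWithinAt) (by simp [hx, hy])
    (fun z hz => hd z (Set.Ioo_subset_Icc_self hz))
  refine ⟨z, hz, ?_⟩
  have hz0 := hne z (Set.Ioo_subset_Icc_self hz)
  have h1 : Real.exp (-s * Real.log z) * (z⁻¹ * (z * (derivative f).eval z - s * f.eval z)) = 0 := by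
    rw [← hz']; field_simp; ring
  have h2 := (mul_eq_zero.1 h1).resolve_left (Real.exp_pos _).ne'
  simpa [eulerOp_apply] using (mul_eq_zero.1 h2).resolve_left (inv_ne_zero hz0)

/-- A real polynomial killed by `θ - s` is a monomial, so that it has no zero off the origin. -/
lemma eulerOp_sub_ne_zero {f : ℝ[X]} (hf : f ≠ 0) (s : ℝ) {x : ℝ} (hx0 : x ≠ 0)
    (hx : f.IsRoot x) : eulerOp f - C s * f ≠ 0 := by
  intro h
  have hm : ∀ k : ℕ, k ∈ f.support → (k : ℝ) = s := by
    intro k hk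
    have := congrArg (coeff · k) h
    simp only [coeff_sub, coeff_eulerOp, coeff_C_mul, coeff_zero, ← sub_mul] at this
    exact sub_eq_zero.1 ((mul_eq_zero.1 this).resolve_right (mem_support_iff.1 hk))
  have hs : f.support = {f.natDegree} := by
    refine Finset.eq_singleton_iff_unique_mem.2 ⟨natDegree_mem_support_of_nonzero hf, ?_⟩
    intro k hk
    exact_mod_cast (hm k hk).trans (hm _ (natDegree_mem_support_of_nonzero hf)).symm
  rw [IsRoot, eval_eq_sum, sum_def, hs, Finset.sum_singleton] at hx
  exact (mul_ne_zero (by simpa using hf) (pow_ne_zero _ hx0)) hx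

lemma rootMultiplicity_sub_one_le_eulerOp_sub {f : ℝ[X]} {s x : ℝ}
    (hg : eulerOp f - C s * f ≠ 0) :
    f.rootMultiplicity x - 1 ≤ (eulerOp f - C s * f).rootMultiplicity x := by
  rw [le_rootMultiplicity_iff hg]
  have h1 : (X - C x) ^ (f.rootMultiplicity x - 1) ∣ f :=
    (pow_dvd_pow _ (Nat.sub_le _ _)).trans (pow_rootMultiplicity_dvd f x)
  have h2 : (X - C x) ^ (f.rootMultiplicity x - 1) ∣ derivative f :=
    pow_sub_one_dvd_derivative_of_pow_dvd (pow_rootMultiplicity_dvd f x)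
  exact dvd_sub (h2.mul_left _) (h1.mul_left _)

open Classical in
/-- **Rolle's theorem for `θ - s`**, with multiplicities, on an interval that misses the origin. -/
lemma countP_roots_le_eulerOp_sub (f : ℝ[X]) (s : ℝ) {I : Set ℝ} (hI : I.OrdConnected)
    (h0 : (0 : ℝ) ∉ I) :
    f.roots.countP (· ∈ I) ≤ (eulerOp f - C s * f).roots.countP (· ∈ I) + 1 := by
  rcases Nat.eq_zero_or_pos (f.roots.countP (· ∈ I)) with h | h
  · omega
  obtain ⟨x, hx, hxI⟩ := Multiset.countP_pos.1 h
  have hf : f ≠ 0 := ne_zero_of_mem_roots hx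
  have hg := eulerOp_sub_ne_zero hf s (fun h => h0 (h ▸ hxI)) (isRoot_of_mem_roots hx)
  set g := eulerOp f - C s * f with hgdef
  set F := f.roots.toFinset.filter (· ∈ I) with hF
  set G := g.roots.toFinset.filter (· ∈ I) with hG
  have key : ∀ p : ℝ[X], p.roots.countP (· ∈ I)
      = ∑ x ∈ p.roots.toFinset.filter (· ∈ I), p.rootMultiplicity x := by
    intro p
    rw [Multiset.countP_eq_card_filter, ← Multiset.toFinset_sum_count_eq,
      Multiset.toFinset_filter]
    refine Finset.sum_congr rfl fun x hx => ?_
    rw [Multiset.count_filter_of_pos (Finset.mem_filter.1 hx).2, count_roots]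
  have hFG : F.card ≤ (G \ F).card + 1 := by
    refine Finset.card_le_sdiff_of_interleaved fun x hx y hy hxy _ => ?_
    simp only [hF, Finset.mem_filter, Multiset.mem_toFinset, mem_roots hf] at hx hy
    have hsub : Set.Icc x y ⊆ I := hI.out hx.2 hy.2
    obtain ⟨z, hz, hz0⟩ := exists_isRoot_eulerOp_sub s hxy (fun h => h0 (hsub h)) hx.1 hy.1
    refine ⟨z, ?_, hz.1, hz.2⟩
    simp only [hG, Finset.mem_filter, Multiset.mem_toFinset, mem_roots hg]
    exact ⟨hz0, hsub (Set.Ioo_subset_Icc_self hz)⟩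
  rw [key f, key g]
  calc ∑ x ∈ F, f.rootMultiplicity x
      ≤ ∑ x ∈ F, (g.rootMultiplicity x + 1) := Finset.sum_le_sum fun x _ => by
        have : f.rootMultiplicity x - 1 ≤ g.rootMultiplicity x :=
          rootMultiplicity_sub_one_le_eulerOp_sub hg
        omega
    _ = ∑ x ∈ F, g.rootMultiplicity x + F.card := by
        rw [Finset.sum_add_distrib, Finset.card_eq_sum_ones]
    _ ≤ ∑ x ∈ F, g.rootMultiplicity x + (∑ x ∈ G \ F, g.rootMultiplicity x + 1) := by
        gcongr
        refine hFG.trans (Nat.add_le_add_right ?_ 1)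
        rw [Finset.card_eq_sum_ones]
        refine Finset.sum_le_sum fun x hx => ?_
        have hx' := (Finset.mem_filter.1 (Finset.mem_sdiff.1 hx).1).1
        rw [Multiset.mem_toFinset] at hx'
        exact (rootMultiplicity_pos hg).2 (isRoot_of_mem_roots hx')
    _ = ∑ x ∈ F ∪ G, g.rootMultiplicity x + 1 := by
        rw [← add_assoc, ← Finset.sum_union Finset.disjoint_sdiff,
          Finset.union_sdiff_self_eq_union]
    _ = ∑ x ∈ G, g.rootMultiplicity x + 1 := by
        congr 1
        refine (Finset.sum_subset Finset.subset_union_right fun x hx hxG => ?_).symm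
        have hxI : x ∈ I := by
          rcases Finset.mem_union.1 hx with h | h
          · exact (Finset.mem_filter.1 h).2
          · exact absurd h hxG
        by_contra hne
        exact hxG (Finset.mem_filter.2 ⟨Multiset.mem_toFinset.2
          ((mem_roots hg).2 ((rootMultiplicity_pos hg).1 (Nat.pos_of_ne_zero hne))), hxI⟩)

open Classical in
/-- Multiplying the `k`-th coefficient by `Q(k)`, where `Q` has only real zeros, lowers the number
of zeros in an interval that misses the origin by at most `deg Q`. -/
lemma countP_roots_le_aeval_eulerOp {Q : ℝ[X]} (hQ : Q.Splits) (hQ0 : Q ≠ 0) (f : ℝ[X])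
    {I : Set ℝ} (hI : I.OrdConnected) (h0 : (0 : ℝ) ∉ I) :
    f.roots.countP (· ∈ I) ≤ (aeval eulerOp Q f).roots.countP (· ∈ I) + Q.natDegree := by
  have key : ∀ m : Multiset ℝ, ∀ f : ℝ[X], f.roots.countP (· ∈ I) ≤
      (aeval eulerOp (m.map (X - C ·)).prod f).roots.countP (· ∈ I) + m.card := by
    intro m
    induction m using Multiset.induction_on with
    | empty => intro f; simp
    | cons a m ih =>
      intro f
      have h1 := countP_roots_le_eulerOp_sub f a hI h0
      have h2 := ih (eulerOp f - C a * f)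
      rw [Multiset.map_cons, Multiset.prod_cons, mul_comm, map_mul, Module.End.mul_apply,
        Multiset.card_cons]
      have : (aeval eulerOp (X - C a)) f = eulerOp f - C a * f := by
        simp [C_mul']
      rw [this]
      omega
  have h := key Q.roots f
  rw [hQ.natDegree_eq_card_roots]
  conv_rhs => rw [hQ.eq_prod_roots]
  rw [map_mul, Module.End.mul_apply, aeval_C, Module.algebraMap_end_apply,
    roots_smul_nonzero _ (leadingCoeff_ne_zero.2 hQ0)]
  have : (C Q.leadingCoeff * (Multiset.map (fun x => X - C x) Q.roots).prod).roots = Q.roots := by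
    rw [← hQ.eq_prod_roots]
  simpa only [this] using h

end EulerOperator

/-! ### Multipliers that isolate one coefficient -/

section Multiplier

open Polynomial

open Classical in
/-- If one coefficient of `f`, weighted by `Q`, dominates the sum of all the others, and its
monomial is the largest one on `I`, then `Q(θ) f` has no zero in `I`, and so `f` has at most
`deg Q` zeros there. -/
lemma countP_roots_le_natDegree_of_dominant {f Q : ℝ[X]} {n m : ℕ} (hf : f.natDegree ≤ n)
    (hm : m ≤ n) (hQ : Q.Splits) {I : Set ℝ} (hI : I.OrdConnected) (h0 : (0 : ℝ) ∉ I)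
    (hpow : ∀ x ∈ I, ∀ k ≤ n, Q.eval (k : ℝ) ≠ 0 → |x| ^ k ≤ |x| ^ m)
    (hdom : ∑ k ∈ (Finset.range (n + 1)).erase m, |Q.eval (k : ℝ)| * |f.coeff k| <
      |Q.eval (m : ℝ)| * |f.coeff m|) :
    f.roots.countP (· ∈ I) ≤ Q.natDegree := by
  have hQ0 : Q ≠ 0 := by
    rintro rfl
    simp at hdom
  have h := countP_roots_le_aeval_eulerOp hQ hQ0 f hI h0
  suffices h' : (aeval eulerOp Q f).roots.countP (· ∈ I) = 0 by omega
  rw [Multiset.countP_eq_zero]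
  intro x hx hxI
  have hroot : (aeval eulerOp Q f).eval x = 0 := isRoot_of_mem_roots hx
  have hdeg : (aeval eulerOp Q f).natDegree < n + 1 := by
    refine Nat.lt_succ_of_le (natDegree_le_iff_coeff_eq_zero.2 fun k hk => ?_)
    rw [coeff_aeval_eulerOp, coeff_eq_zero_of_natDegree_lt (hf.trans_lt hk), mul_zero]
  rw [eval_eq_sum_range' hdeg, ← Finset.add_sum_erase _ _ (Finset.mem_range_succ_iff.2 hm)] at hroot
  have hxm : 0 < |x| ^ m := pow_pos (abs_pos.2 fun h => h0 (h ▸ hxI)) m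
  have hlt : |∑ k ∈ (Finset.range (n + 1)).erase m, (aeval eulerOp Q f).coeff k * x ^ k| <
      |(aeval eulerOp Q f).coeff m * x ^ m| := by
    calc _ ≤ ∑ k ∈ (Finset.range (n + 1)).erase m, |(aeval eulerOp Q f).coeff k * x ^ k| :=
          Finset.abs_sum_le_sum_abs _ _
      _ ≤ ∑ k ∈ (Finset.range (n + 1)).erase m, |Q.eval (k : ℝ)| * |f.coeff k| * |x| ^ m := by
          refine Finset.sum_le_sum fun k hk => ?_
          rw [coeff_aeval_eulerOp, abs_mul, abs_mul, abs_pow]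
          by_cases hq : Q.eval (k : ℝ) = 0
          · simp [hq]
          · exact mul_le_mul_of_nonneg_left (hpow x hxI k
              (Finset.mem_range_succ_iff.1 (Finset.mem_of_mem_erase hk)) hq) (by positivity)
      _ < _ := by
          rw [← Finset.sum_mul, coeff_aeval_eulerOp, abs_mul, abs_mul, abs_pow]
          exact mul_lt_mul_of_pos_right hdom hxm
  rw [eq_neg_of_add_eq_zero_left hroot, abs_neg] at hlt
  exact lt_irrefl _ hlt

/-- The product of `N` distinct nonzero integers is at least `N! / 2 ^ N` in absolute value: the
largest of them is at least `N / 2`. -/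
lemma factorial_card_le_two_pow_mul_prod (S : Finset ℤ) (h0 : (0 : ℤ) ∉ S) :
    S.card.factorial ≤ 2 ^ S.card * ∏ s ∈ S, s.natAbs := by
  induction hc : S.card generalizing S with
  | zero => simp [Finset.card_eq_zero.1 hc]
  | succ c ih =>
    obtain ⟨m, hmS, hmax⟩ := S.exists_max_image Int.natAbs (Finset.card_pos.1 (by omega))
    have h1 := ih (S.erase m) (fun h => h0 (Finset.mem_of_mem_erase h))
      (by rw [Finset.card_erase_of_mem hmS, hc]; rfl)
    have h2 : c + 1 ≤ 2 * m.natAbs := by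
      have hsub : S ⊆ (Finset.Icc (-(m.natAbs : ℤ)) m.natAbs).erase 0 := fun s hs => by
        have := hmax s hs
        rw [Finset.mem_erase, Finset.mem_Icc]
        exact ⟨fun h => h0 (h ▸ hs), by omega, by omega⟩
      have := Finset.card_le_card hsub
      rw [hc, Finset.card_erase_of_mem (Finset.mem_Icc.2 ⟨by omega, by omega⟩), Int.card_Icc] at this
      omega
    rw [← Finset.mul_prod_erase _ _ hmS, Nat.factorial_succ, pow_succ]
    calc (c + 1) * c.factorial ≤ (2 * m.natAbs) * (2 ^ c * ∏ s ∈ S.erase m, s.natAbs) :=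
          Nat.mul_le_mul h2 h1
      _ = _ := by ring

lemma splits_chebyshev_T (d : ℕ) : (Chebyshev.T ℝ d).Splits := by
  rw [splits_iff_card_roots, Chebyshev.roots_T_real, Chebyshev.natDegree_T, Finset.card_val,
    Finset.card_image_of_injOn]
  · simp
  · have h := Chebyshev.roots_T_real_nodup d
    rw [Multiset.nodup_map_iff_inj_on (Multiset.nodup_range d)] at h
    intro x hx y hy hxy
    exact h x (by simpa using hx) y (by simpa using hy) hxy

/-- A real-rooted polynomial `Q` that vanishes on `S`, is at most `n ^ |S|` at the other indices
`k ≠ m`, and is large at `m`. It is the product of `∏ (X - s)` over `S` and a Chebyshev polynomial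
`T_d ∘ ℓ`, where the affine map `ℓ` sends the other indices into `[-1, 1]` and `m` to `cosh t`.
The sign `e` tells on which side of `m` those indices lie. -/
lemma exists_multiplier {n m : ℕ} (hn : 0 < n) (hm : m ≤ n) {S : Finset ℕ}
    (hS : S ⊆ Finset.range (n + 1)) (hmS : m ∉ S) {e j t : ℝ} (he : |e| = 1)
    (hsep : ∀ k ≤ n, k ∉ S → k ≠ m → j * n ≤ e * ((k : ℝ) - m))
    (ht : Real.cosh t - 1 ≤ 2 * j) (d : ℕ) :
    ∃ Q : ℝ[X], Q.Splits ∧ Q.natDegree ≤ S.card + d ∧ (∀ s ∈ S, Q.eval (s : ℝ) = 0) ∧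
      S.card.factorial * Real.cosh (d * t) ≤ 2 ^ S.card * |Q.eval (m : ℝ)| ∧
      ∀ k ≤ n, k ≠ m → |Q.eval (k : ℝ)| ≤ (n : ℝ) ^ S.card := by
  have hn' : (0 : ℝ) < n := by exact_mod_cast hn
  set ℓ : ℝ[X] := C (-(2 * e / n)) * X + C (Real.cosh t + 2 * e * m / n) with hℓ
  have hℓe : ∀ x : ℝ, ℓ.eval x = Real.cosh t - 2 * (e * (x - m)) / n := fun x => by
    simp [hℓ]; ring
  have hℓd : ℓ.natDegree ≤ 1 := natDegree_linear_le
  refine ⟨(∏ s ∈ S, (X - C (s : ℝ))) * (Chebyshev.T ℝ d).comp ℓ, ?_, ?_, ?_, ?_, ?_⟩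
  · exact (Splits.prod fun s _ => Splits.X_sub_C _).mul
      ((splits_chebyshev_T d).comp_of_natDegree_le_one hℓd)
  · refine natDegree_mul_le.trans (add_le_add ?_ ?_)
    · refine (natDegree_prod_le _ _).trans ?_
      simp only [natDegree_X_sub_C, Finset.sum_const, smul_eq_mul, mul_one, le_refl]
    · refine natDegree_comp_le.trans ?_
      simpa using Nat.mul_le_mul_left d hℓd
  · intro s hs
    rw [eval_mul, eval_prod, Finset.prod_eq_zero hs (by simp), zero_mul]
  · have hcosh : (Chebyshev.T ℝ d).eval (ℓ.eval (m : ℝ)) = Real.cosh (d * t) := by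
      rw [hℓe]; simp
    rw [eval_mul, eval_comp, hcosh, abs_mul, abs_of_pos (Real.cosh_pos _), ← mul_assoc]
    refine mul_le_mul_of_nonneg_right ?_ (Real.cosh_pos _).le
    have h := factorial_card_le_two_pow_mul_prod (S.image fun s : ℕ => (m : ℤ) - s) (by
      intro h
      obtain ⟨s, hs, hs'⟩ := Finset.mem_image.1 h
      have : m = s := by omega
      exact hmS (this ▸ hs))
    rw [Finset.card_image_of_injective _ (fun a b h => by simpa using h),
      Finset.prod_image (fun a _ b _ h => by simpa using h)] at h
    have h' : (S.card.factorial : ℝ) ≤ 2 ^ S.card * ∏ s ∈ S, (((m : ℤ) - s).natAbs : ℝ) := by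
      exact_mod_cast h
    refine h'.trans_eq ?_
    rw [eval_prod, Finset.abs_prod]
    congr 1
    refine Finset.prod_congr rfl fun s _ => ?_
    simp [Nat.cast_natAbs]
  · intro k hk hkm
    by_cases hkS : k ∈ S
    · rw [eval_mul, eval_prod, Finset.prod_eq_zero hkS (by simp), zero_mul, abs_zero]
      positivity
    · rw [eval_mul, eval_comp, abs_mul, eval_prod, Finset.abs_prod]
      have hT : |(Chebyshev.T ℝ d).eval (ℓ.eval (k : ℝ))| ≤ 1 := by
        refine Chebyshev.abs_eval_T_real_le_one _ ?_
        have h1 := hsep k hk hkS hkm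
        have h2 : e * ((k : ℝ) - m) ≤ n := by
          refine (le_abs_self _).trans ?_
          rw [abs_mul, he, one_mul, abs_le]
          have : (k : ℝ) ≤ n := by exact_mod_cast hk
          have : (m : ℝ) ≤ n := by exact_mod_cast hm
          constructor <;> linarith [k.cast_nonneg (α := ℝ), m.cast_nonneg (α := ℝ)]
        have h3 : e * ((k : ℝ) - m) / n ≤ 1 := (div_le_one hn').2 h2
        have h4 : j ≤ e * ((k : ℝ) - m) / n := (le_div_iff₀ hn').2 h1
        rw [hℓe, mul_div_assoc, abs_le]
        constructor <;> linarith [Real.one_le_cosh t]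
      have hP : ∏ s ∈ S, |(X - C (s : ℝ)).eval (k : ℝ)| ≤ (n : ℝ) ^ S.card := by
        rw [← Finset.prod_const]
        refine Finset.prod_le_prod (fun _ _ => abs_nonneg _) fun s hs => ?_
        have h1 : s ≤ n := Finset.mem_range_succ_iff.1 (hS hs)
        have : (k : ℝ) ≤ n := by exact_mod_cast hk
        have : (s : ℝ) ≤ n := by exact_mod_cast h1
        rw [eval_sub, eval_X, eval_C, abs_le]
        constructor <;> linarith [k.cast_nonneg (α := ℝ), s.cast_nonneg (α := ℝ)]
      calc _ ≤ (n : ℝ) ^ S.card * 1 := mul_le_mul hP hT (abs_nonneg _) (by positivity)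
        _ = _ := mul_one _

end Multiplier

/-! ### A deterministic bound for the number of real zeros -/

section Deterministic

open Polynomial

lemma two_mul_pow_le_factorial_mul_exp {τ : ℝ} (h0 : 0 < τ) (h1 : τ ≤ 1) {n N : ℕ}
    (hN : (N : ℝ) ≤ 3 * τ ^ 4 * n) :
    (2 * (n : ℝ)) ^ N ≤ N.factorial * Real.exp (14 * τ ^ 3 * n) := by
  have hfac : (0 : ℝ) < N.factorial := by exact_mod_cast N.factorial_pos
  -- One term of the exponential series of `2 n τ ^ 4` bounds `(2 n τ ^ 4) ^ N / N!`.
  have e1 : (2 * (n : ℝ) * τ ^ 4) ^ N ≤ N.factorial * Real.exp (2 * n * τ ^ 4) := by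
    have := Real.pow_div_factorial_le_exp (2 * (n : ℝ) * τ ^ 4) (by positivity) N
    rwa [div_le_iff₀' hfac] at this
  have e2 : (τ⁻¹ ^ 4) ^ N ≤ Real.exp (12 * τ ^ 3 * n) := by
    have h : τ⁻¹ ≤ Real.exp τ⁻¹ := by linarith [Real.add_one_le_exp τ⁻¹]
    calc (τ⁻¹ ^ 4) ^ N ≤ (Real.exp τ⁻¹ ^ 4) ^ N := by gcongr
      _ = Real.exp (N * (4 * τ⁻¹)) := by rw [← Real.exp_nat_mul, ← Real.exp_nat_mul]; norm_num
      _ ≤ _ := by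
        refine Real.exp_le_exp.2 ?_
        calc (N : ℝ) * (4 * τ⁻¹) ≤ (3 * τ ^ 4 * n) * (4 * τ⁻¹) := by gcongr
          _ = _ := by field_simp; ring
  calc (2 * (n : ℝ)) ^ N = (2 * (n : ℝ) * τ ^ 4) ^ N * (τ⁻¹ ^ 4) ^ N := by
        rw [← mul_pow]; congr 1; field_simp
    _ ≤ N.factorial * Real.exp (2 * n * τ ^ 4) * Real.exp (12 * τ ^ 3 * n) := by gcongr
    _ = N.factorial * Real.exp (2 * n * τ ^ 4 + 12 * τ ^ 3 * n) := by
        rw [mul_assoc, Real.exp_add]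
    _ ≤ _ := by
        refine mul_le_mul_of_nonneg_left (Real.exp_le_exp.2 ?_) hfac.le
        have : τ ^ 4 ≤ τ ^ 3 := pow_le_pow_of_le_one h0.le h1 (by norm_num)
        nlinarith [mul_le_mul_of_nonneg_left this (n.cast_nonneg (α := ℝ))]

/-- A Chebyshev factor of degree about `15 τ n` outweighs the loss `(2 n) ^ N / N!` that comes from
killing `N ≤ 3 τ ^ 4 n` indices, together with the ratio `A / a` of the coefficients. -/
lemma eventually_lt_mul_cosh {τ A a : ℝ} (h0 : 0 < τ) (h1 : τ ≤ 1) (hA : 0 < A) (ha : 0 < a) :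
    ∀ᶠ n : ℕ in atTop, ∀ N : ℕ, (N : ℝ) ≤ 3 * τ ^ 4 * n →
      A * n * (2 * (n : ℝ)) ^ N <
        a * (N.factorial * Real.cosh (⌈15 * τ * n⌉₊ * τ ^ 2)) := by
  filter_upwards [eventually_gt_atTop 0, tendsto_natCast_atTop_atTop.eventually_gt_atTop
    (4 * A / (a * τ ^ 6))] with n hn0 hn N hN
  have hn0' : (0 : ℝ) < n := by exact_mod_cast hn0
  have hfac : (0 : ℝ) < N.factorial := by exact_mod_cast N.factorial_pos
  have hpow := two_mul_pow_le_factorial_mul_exp h0 h1 hN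
  have hcosh : Real.exp (15 * τ ^ 3 * n) ≤ 2 * Real.cosh (⌈15 * τ * n⌉₊ * τ ^ 2) := by
    calc Real.exp (15 * τ ^ 3 * n) ≤ Real.exp (⌈15 * τ * n⌉₊ * τ ^ 2) := by
          refine Real.exp_le_exp.2 ?_
          calc 15 * τ ^ 3 * n = 15 * τ * n * τ ^ 2 := by ring
            _ ≤ _ := by gcongr; exact Nat.le_ceil _
      _ ≤ _ := by rw [Real.cosh_eq]; linarith [Real.exp_pos (-((⌈15 * τ * n⌉₊ : ℝ) * τ ^ 2))]
  have hgrow : 2 * A * n < a * Real.exp (τ ^ 3 * n) := by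
    have h2 := Real.quadratic_le_exp_of_nonneg (x := τ ^ 3 * n) (by positivity)
    have h3 : 4 * A < n * (a * τ ^ 6) := (div_lt_iff₀ (by positivity)).1 hn
    have h4 : (τ ^ 3 * n) ^ 2 / 2 ≤ Real.exp (τ ^ 3 * n) := by
      have : 0 ≤ τ ^ 3 * (n : ℝ) := by positivity
      linarith
    calc 2 * A * n = 4 * A * (n / 2) := by ring
      _ < n * (a * τ ^ 6) * (n / 2) := by gcongr
      _ = a * ((τ ^ 3 * n) ^ 2 / 2) := by ring
      _ ≤ _ := by gcongr
  calc A * n * (2 * (n : ℝ)) ^ N ≤ A * n * (N.factorial * Real.exp (14 * τ ^ 3 * n)) := by gcongr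
    _ = (2 * A * n) * (N.factorial * Real.exp (14 * τ ^ 3 * n) / 2) := by ring
    _ < (a * Real.exp (τ ^ 3 * n)) * (N.factorial * Real.exp (14 * τ ^ 3 * n) / 2) := by gcongr
    _ = a * (N.factorial * (Real.exp (15 * τ ^ 3 * n) / 2)) := by
        rw [show 15 * τ ^ 3 * (n : ℝ) = τ ^ 3 * n + 14 * τ ^ 3 * n by ring, Real.exp_add]; ring
    _ ≤ _ := by
        gcongr
        linarith

lemma cosh_sq_sub_one_le {τ : ℝ} (h0 : 0 ≤ τ) (h1 : τ ≤ 1) :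
    Real.cosh (τ ^ 2) - 1 ≤ 2 * τ ^ 4 := by
  have h4 : τ ^ 4 ≤ 1 := pow_le_one₀ h0 h1
  have h := Real.cosh_le_exp_half_sq (τ ^ 2)
  have h2 := Real.abs_exp_sub_one_le (x := (τ ^ 2) ^ 2 / 2) (by
    rw [abs_of_nonneg (by positivity)]; nlinarith)
  rw [abs_of_nonneg (a := (τ ^ 2) ^ 2 / 2) (by positivity)] at h2
  have := (abs_le.1 h2).2
  nlinarith [pow_nonneg h0 4]

open Classical in
/-- The zeros in one of the four intervals cut out by `-1`, `0` and `1`. The index `m` is close to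
the end of `{0, …, n}` on the side where the monomials are large on `I`; the multiplier kills the
indices beyond `m`, those within `τ ^ 4 n` of `m`, and those with large coefficients. -/
lemma eventually_countP_roots_le {τ A a : ℝ} (h0 : 0 < τ) (h1 : τ ≤ 1) (hA : 0 < A) (ha : 0 < a) :
    ∀ᶠ n : ℕ in atTop, ∀ (f : ℝ[X]) (m : ℕ) (e : ℝ) (I : Set ℝ), f.natDegree ≤ n → m ≤ n →
      |e| = 1 → I.OrdConnected → (0 : ℝ) ∉ I →
      (∀ x ∈ I, ∀ k ≤ n, 0 ≤ e * ((k : ℝ) - m) → |x| ^ k ≤ |x| ^ m) →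
      (((Finset.range (n + 1)).filter fun k => A < |f.coeff k|).card : ℝ) ≤ τ ^ 4 * n →
      (((Finset.range (n + 1)).filter fun k : ℕ =>
        k ≠ m ∧ e * ((k : ℝ) - m) < τ ^ 4 * n).card : ℝ) ≤ 2 * τ ^ 4 * n →
      a ≤ |f.coeff m| →
      (f.roots.countP (· ∈ I) : ℝ) ≤ 3 * τ ^ 4 * n + (15 * τ * n + 1) := by
  filter_upwards [eventually_lt_mul_cosh h0 h1 hA ha, eventually_gt_atTop 0]
    with n hn hn0 f m e I hf hm he hI hI0 hpow hbad hside ham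
  set S := (Finset.range (n + 1)).filter fun k : ℕ =>
    k ≠ m ∧ (A < |f.coeff k| ∨ e * ((k : ℝ) - m) < τ ^ 4 * n) with hS
  have hScard : (S.card : ℝ) ≤ 3 * τ ^ 4 * n := by
    have hsub : S ⊆ ((Finset.range (n + 1)).filter fun k => A < |f.coeff k|) ∪
        ((Finset.range (n + 1)).filter fun k : ℕ => k ≠ m ∧ e * ((k : ℝ) - m) < τ ^ 4 * n) := by
      intro k hk
      simp only [hS, Finset.mem_filter, Finset.mem_union] at hk ⊢
      tauto
    have := Nat.cast_le (α := ℝ).2 ((Finset.card_le_card hsub).trans (Finset.card_union_le _ _))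
    rw [Nat.cast_add] at this
    linarith
  have hout : ∀ k ≤ n, k ∉ S → k ≠ m → |f.coeff k| ≤ A ∧ τ ^ 4 * n ≤ e * ((k : ℝ) - m) := by
    intro k hk hkS hkm
    simp only [hS, Finset.mem_filter, Finset.mem_range_succ_iff, not_and, not_or, not_lt] at hkS
    exact hkS hk hkm
  obtain ⟨Q, hQs, hQd, hQS, hQm, hQk⟩ := exists_multiplier hn0 hm (S := S)
    (Finset.filter_subset _ _) (by simp [hS]) he (fun k hk hkS hkm => (hout k hk hkS hkm).2)
    (cosh_sq_sub_one_le h0.le h1) ⌈15 * τ * n⌉₊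
  have key : f.roots.countP (· ∈ I) ≤ Q.natDegree := by
    refine countP_roots_le_natDegree_of_dominant hf hm hQs hI hI0 ?_ ?_
    · intro x hx k hk hQk0
      rcases eq_or_ne k m with rfl | hkm
      · exact le_rfl
      · refine hpow x hx k hk (le_trans (by positivity)
          (hout k hk (fun hkS => hQk0 (hQS k hkS)) hkm).2)
    · have hsum : ∑ k ∈ (Finset.range (n + 1)).erase m, |Q.eval (k : ℝ)| * |f.coeff k| ≤
          n * ((n : ℝ) ^ S.card * A) := by
        have hle : ∀ k ∈ (Finset.range (n + 1)).erase m,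
            |Q.eval (k : ℝ)| * |f.coeff k| ≤ (n : ℝ) ^ S.card * A := by
          intro k hk
          obtain ⟨hkm, hk⟩ := Finset.mem_erase.1 hk
          rw [Finset.mem_range_succ_iff] at hk
          by_cases hkS : k ∈ S
          · rw [hQS k hkS, abs_zero, zero_mul]; positivity
          · exact mul_le_mul (hQk k hk hkm) (hout k hk hkS hkm).1 (abs_nonneg _) (by positivity)
        refine (Finset.sum_le_card_nsmul _ _ _ hle).trans_eq ?_
        rw [Finset.card_erase_of_mem (Finset.mem_range_succ_iff.2 hm), Finset.card_range,
          nsmul_eq_mul, Nat.succ_sub_one]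
      have hlt := hn S.card hScard
      rw [mul_pow] at hlt
      have h2 : (0 : ℝ) < 2 ^ S.card := by positivity
      refine lt_of_mul_lt_mul_left ?_ h2.le
      calc 2 ^ S.card * ∑ k ∈ (Finset.range (n + 1)).erase m, |Q.eval (k : ℝ)| * |f.coeff k|
          ≤ 2 ^ S.card * (n * ((n : ℝ) ^ S.card * A)) := by gcongr
        _ = A * n * (2 ^ S.card * (n : ℝ) ^ S.card) := by ring
        _ < _ := hlt
        _ ≤ a * (2 ^ S.card * |Q.eval (m : ℝ)|) := by gcongr
        _ ≤ |f.coeff m| * (2 ^ S.card * |Q.eval (m : ℝ)|) := by gcongr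
        _ = _ := by ring
  have h2 : (f.roots.countP (· ∈ I) : ℝ) ≤ S.card + ⌈15 * τ * n⌉₊ := by
    exact_mod_cast key.trans hQd
  have h3 := (Nat.ceil_lt_add_one (a := 15 * τ * n) (by positivity)).le
  linarith

lemma card_filter_lt_add_le {n m : ℕ} {x : ℝ} (hx : 0 < x) :
    (((Finset.range (n + 1)).filter fun k : ℕ =>
      k ≠ m ∧ (k : ℝ) - m < x).card : ℝ) ≤ m + x := by
  have hm : (0 : ℝ) ≤ m := m.cast_nonneg
  have hlt : m < ⌈m + x⌉₊ := Nat.lt_ceil.2 (by linarith)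
  have hsub : ((Finset.range (n + 1)).filter fun k : ℕ => k ≠ m ∧ (k : ℝ) - m < x) ⊆
      (Finset.range ⌈m + x⌉₊).erase m := fun k hk => by
    simp only [Finset.mem_filter, Finset.mem_erase, Finset.mem_range] at hk ⊢
    exact ⟨hk.2.1, Nat.lt_ceil.2 (by linarith [hk.2.2])⟩
  have hc := Finset.card_le_card hsub
  rw [Finset.card_erase_of_mem (Finset.mem_range.2 hlt), Finset.card_range] at hc
  have h3 := Nat.ceil_lt_add_one (a := m + x) (by linarith)
  have h4 := Nat.cast_le (α := ℝ).2 hc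
  rw [Nat.cast_sub (by omega), Nat.cast_one] at h4
  linarith

lemma card_filter_sub_lt_le {n m : ℕ} (hm : m ≤ n) {x : ℝ} (hx : 0 < x) :
    (((Finset.range (n + 1)).filter fun k : ℕ =>
      k ≠ m ∧ (m : ℝ) - k < x).card : ℝ) ≤ ((n : ℝ) - m) + x := by
  refine le_trans ?_ ((card_filter_lt_add_le (n := n) (m := n - m) hx).trans_eq (by
    rw [Nat.cast_sub hm]))
  refine Nat.cast_le.2 (Finset.card_le_card_of_injOn (n - ·) ?_ ?_)
  · intro k hk
    simp only [Finset.coe_filter, Finset.mem_range_succ_iff, Set.mem_ofPred_eq] at hk ⊢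
    refine ⟨Nat.sub_le _ _, by omega, ?_⟩
    rw [Nat.cast_sub hk.1, Nat.cast_sub hm]
    linarith [hk.2.2]
  · intro k hk l hl hkl
    simp only [Finset.coe_filter, Finset.mem_range_succ_iff, Set.mem_ofPred_eq] at hk hl
    have : n - k = n - l := hkl
    omega

open Classical in
lemma card_le_count_zero_add_countP {I₁ I₂ I₃ I₄ : Set ℝ}
    (h : ∀ x, x = 0 ∨ x ∈ I₁ ∨ x ∈ I₂ ∨ x ∈ I₃ ∨ x ∈ I₄) (s : Multiset ℝ) :
    s.card ≤ s.count 0 + (s.countP (· ∈ I₁) + s.countP (· ∈ I₂) +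
      (s.countP (· ∈ I₃) + s.countP (· ∈ I₄))) := by
  induction s using Multiset.induction_on with
  | empty => simp
  | cons x s ih =>
    simp only [Multiset.card_cons, Multiset.count_cons, Multiset.countP_cons,
      eq_comm (a := (0 : ℝ))]
    rcases h x with h | h | h | h | h <;> simp only [h, if_true] <;> omega

open Classical in
/-- **The deterministic bound.** If all but `τ ^ 4 n` of the coefficients of a polynomial of degree
at most `n` are bounded by `A`, and there are coefficients of modulus at least `a` within `τ ^ 4 n`
of either end, then for large `n` there are at most `80 τ n` real zeros. -/
theorem eventually_card_roots_le {τ A a : ℝ} (h0 : 0 < τ) (h1 : τ ≤ 1) (hA : 0 < A) (ha : 0 < a) :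
    ∀ᶠ n : ℕ in atTop, ∀ f : ℝ[X], f.natDegree ≤ n →
      (((Finset.range (n + 1)).filter fun k => A < |f.coeff k|).card : ℝ) ≤ τ ^ 4 * n →
      (∃ m ≤ n, (m : ℝ) ≤ τ ^ 4 * n ∧ a ≤ |f.coeff m|) →
      (∃ m ≤ n, (n : ℝ) - m ≤ τ ^ 4 * n ∧ a ≤ |f.coeff m|) →
      (f.roots.card : ℝ) ≤ 80 * τ * n := by
  filter_upwards [eventually_countP_roots_le h0 h1 hA ha, eventually_gt_atTop 0,
    tendsto_natCast_atTop_atTop.eventually_gt_atTop (2 / τ)]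
    with n hn hn0 hn1 f hf hbad ⟨m, hmn, hm, ham⟩ ⟨l, hln, hl, hal⟩
  have hn0' : (0 : ℝ) < n := by exact_mod_cast hn0
  have hx : 0 < τ ^ 4 * n := by positivity
  have hlow : (((Finset.range (n + 1)).filter fun k : ℕ =>
      k ≠ m ∧ (1 : ℝ) * ((k : ℝ) - m) < τ ^ 4 * n).card : ℝ) ≤ 2 * τ ^ 4 * n := by
    have := card_filter_lt_add_le (n := n) (m := m) hx
    simp only [one_mul]
    linarith
  have hhigh : (((Finset.range (n + 1)).filter fun k : ℕ =>
      k ≠ l ∧ (-1 : ℝ) * ((k : ℝ) - l) < τ ^ 4 * n).card : ℝ) ≤ 2 * τ ^ 4 * n := by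
    have := card_filter_sub_lt_le hln hx
    simp only [neg_one_mul, neg_sub]
    linarith
  have hsmall : ∀ x : ℝ, |x| ≤ 1 → ∀ k ≤ n, 0 ≤ (1 : ℝ) * ((k : ℝ) - m) → |x| ^ k ≤ |x| ^ m :=
    fun x hx k _ hkm => pow_le_pow_of_le_one (abs_nonneg x) hx
      (Nat.cast_le (α := ℝ).1 (by linarith))
  have hlarge : ∀ x : ℝ, 1 ≤ |x| → ∀ k ≤ n, 0 ≤ (-1 : ℝ) * ((k : ℝ) - l) → |x| ^ k ≤ |x| ^ l :=
    fun x hx k _ hkl => pow_le_pow_right₀ hx (Nat.cast_le (α := ℝ).1 (by linarith))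
  have c1 := hn f m 1 (Set.Ioc 0 1) hf hmn (by simp) Set.ordConnected_Ioc (by simp)
    (fun x hx => hsmall x (abs_le.2 ⟨by linarith [hx.1], hx.2⟩)) hbad hlow ham
  have c2 := hn f m 1 (Set.Ico (-1) 0) hf hmn (by simp) Set.ordConnected_Ico (by simp)
    (fun x hx => hsmall x (abs_le.2 ⟨hx.1, by linarith [hx.2]⟩)) hbad hlow ham
  have c3 := hn f l (-1) (Set.Ici 1) hf hln (by simp) Set.ordConnected_Ici (by simp)
    (fun x hx => hlarge x (le_abs.2 (Or.inl hx))) hbad hhigh hal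
  have c4 := hn f l (-1) (Set.Iic (-1)) hf hln (by simp) Set.ordConnected_Iic (by simp)
    (fun x hx => hlarge x (le_abs.2 (Or.inr (by linarith [Set.mem_Iic.1 hx])))) hbad hhigh hal
  have hfm : f.coeff m ≠ 0 := abs_pos.1 (ha.trans_le ham)
  have hf0 : f ≠ 0 := by
    rintro rfl
    simp at hfm
  have c0 : (f.roots.count 0 : ℝ) ≤ τ ^ 4 * n := by
    refine le_trans (Nat.cast_le.2 ?_) hm
    rw [count_roots, rootMultiplicity_eq_natTrailingDegree']
    exact natTrailingDegree_le_of_ne_zero hfm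
  have hcover : ∀ x : ℝ, x = 0 ∨ x ∈ Set.Ioc (0 : ℝ) 1 ∨ x ∈ Set.Ici (1 : ℝ) ∨
      x ∈ Set.Ico (-1 : ℝ) 0 ∨ x ∈ Set.Iic (-1 : ℝ) := fun x => by
    simp only [Set.mem_Ioc, Set.mem_Ici, Set.mem_Ico, Set.mem_Iic]
    grind
  have hall : (f.roots.card : ℝ) ≤ _ := Nat.cast_le.2 (card_le_count_zero_add_countP hcover f.roots)
  push_cast at hall
  have h4 : τ ^ 4 ≤ τ := pow_le_of_le_one h0.le h1 (by norm_num)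
  have h5 : τ ^ 4 * n ≤ τ * n := by gcongr
  have h6 : 2 < n * τ := (div_lt_iff₀ h0).1 hn1
  linarith

end Deterministic

/-! ### Measurability of the number of real zeros -/

section Measurability

open Polynomial

lemma continuous_coeff_mul {T : Type*} [TopologicalSpace T] {p q : T → ℝ[X]}
    (hp : ∀ k, Continuous fun x => (p x).coeff k) (hq : ∀ k, Continuous fun x => (q x).coeff k)
    (k : ℕ) : Continuous fun x => (p x * q x).coeff k := by
  simp only [coeff_mul]
  exact continuous_finsetSum _ fun i _ => (hp i.1).mul (hq i.2)

/-- The coefficient sequence of the polynomial `∏ (X - r i) * ∑ h j X ^ j`. -/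
noncomputable def rootsQuotientCoeff (m n : ℕ) (x : (Fin m → ℝ) × (Fin (n + 1) → ℝ)) : ℕ → ℝ :=
  fun k => ((∏ i, (X - C (x.1 i))) * ∑ j : Fin (n + 1), monomial j (x.2 j)).coeff k

lemma continuous_rootsQuotientCoeff (m n : ℕ) : Continuous (rootsQuotientCoeff m n) := by
  refine continuous_pi fun k => continuous_coeff_mul (fun k => ?_) (fun k => ?_) k
  · have h : ∀ s : Finset (Fin m), ∀ k, Continuous
        fun x : (Fin m → ℝ) × (Fin (n + 1) → ℝ) => (∏ i ∈ s, (X - C (x.1 i))).coeff k := by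
      intro s
      induction s using Finset.induction_on with
      | empty => intro k; simpa using continuous_const
      | insert i s hi ih =>
        intro k
        simp only [Finset.prod_insert hi]
        refine continuous_coeff_mul (fun k => ?_) ih k
        simp only [coeff_sub, coeff_C]
        split_ifs <;> fun_prop
    exact h Finset.univ k
  · simp only [finsetSum_coeff, coeff_monomial]
    refine continuous_finsetSum _ fun j _ => ?_
    split_ifs <;> fun_prop

/-- A nonzero polynomial of degree at most `n` has at least `m` real zeros if and only if it is a
product of `m` linear factors and a polynomial of degree at most `n`. -/
lemma le_card_roots_iff {p : ℝ[X]} (hp : p ≠ 0) {m n : ℕ} (hn : p.natDegree ≤ n) :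
    m ≤ p.roots.card ↔ (fun k => p.coeff k) ∈ Set.range (rootsQuotientCoeff m n) := by
  constructor
  · intro hm
    obtain ⟨l, hl, hlm⟩ : ∃ l : List ℝ, (l : Multiset ℝ) ≤ p.roots ∧ l.length = m := by
      refine ⟨p.roots.toList.take m, ?_, by simpa using hm⟩
      conv_rhs => rw [← Multiset.coe_toList p.roots]
      exact Multiset.coe_le.2 (List.take_sublist _ _).subperm
    subst hlm
    obtain ⟨q, hq⟩ := (Multiset.prod_X_sub_C_dvd_iff_le_roots hp _).2 hl
    have hprod : (Multiset.map (fun a => X - C a) (l : Multiset ℝ)).prod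
        = ∏ i, (X - C (l.get i)) := by
      rw [Multiset.map_coe, Multiset.prod_coe, ← List.prod_ofFn]
      congr 1
      conv_lhs => rw [← List.ofFn_get l, List.map_ofFn]
      rfl
    have hq0 : q ≠ 0 := by
      rintro rfl
      exact hp (by simpa using hq)
    have hqn : q.natDegree < n + 1 :=
      Nat.lt_succ_of_le ((natDegree_le_of_dvd ⟨_, hq.trans (mul_comm _ _)⟩ hp).trans hn)
    refine ⟨(l.get, fun j => q.coeff j), funext fun k => ?_⟩
    rw [rootsQuotientCoeff, ← hprod, Fin.sum_univ_eq_sum_range (fun j => monomial j (q.coeff j)),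
      ← as_sum_range' q (n + 1) hqn, ← hq]
  · rintro ⟨⟨r, h⟩, hx⟩
    have hpe : p = (∏ i, (X - C (r i))) * ∑ j : Fin (n + 1), monomial j (h j) :=
      Polynomial.ext fun k => (congrFun hx k).symm
    have hdvd : (Multiset.map (fun a => X - C a) (Finset.univ.val.map r)).prod ∣ p := by
      rw [Multiset.map_map]
      exact ⟨_, hpe⟩
    simpa using Multiset.card_le_card ((Multiset.prod_X_sub_C_dvd_iff_le_roots hp _).1 hdvd)

lemma natDegree_randomPoly_le {Ω : Type*} (η : ℕ → Ω → ℝ) (n : ℕ) (ω : Ω) :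
    (randomPoly η n ω).natDegree ≤ n :=
  natDegree_sum_le_of_forall_le _ _ fun _ hk =>
    (natDegree_C_mul_X_pow_le _ _).trans (Finset.mem_range_succ_iff.1 hk)

lemma coeff_randomPoly {Ω : Type*} (η : ℕ → Ω → ℝ) (n : ℕ) (ω : Ω) (k : ℕ) :
    (randomPoly η n ω).coeff k = if k ≤ n then η k ω else 0 := by
  simp only [randomPoly, finsetSum_coeff, coeff_C_mul_X_pow]
  simp

/-- The polynomials of bounded degree with at least `m` real zeros form, away from `0`, a
continuous image of a `σ`-compact space, hence a Borel set. -/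
lemma measurable_numRealRoots {Ω : Type*} [MeasurableSpace Ω] {η : ℕ → Ω → ℝ}
    (hη : ∀ k, Measurable (η k)) (n : ℕ) : Measurable (numRealRoots η n) := by
  have hcoeff : Measurable fun ω => fun k => (randomPoly η n ω).coeff k := by
    refine measurable_pi_lambda _ fun k => ?_
    simp only [coeff_randomPoly]
    split_ifs
    · exact hη k
    · exact measurable_const
  have hzero : MeasurableSet {ω | randomPoly η n ω = 0} := by
    have : {ω | randomPoly η n ω = 0} =
        (fun ω => fun k => (randomPoly η n ω).coeff k) ⁻¹' {fun _ => 0} := by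
      ext ω
      simp [Polynomial.ext_iff, funext_iff]
    rw [this]
    exact hcoeff (measurableSet_singleton _)
  refine measurable_of_Ici fun m => ?_
  rcases Nat.eq_zero_or_pos m with rfl | hm
  · simp
  have hrange : MeasurableSet (Set.range (rootsQuotientCoeff m n)) := by
    obtain ⟨K, hK, hKU⟩ := isSigmaCompact_range (continuous_rootsQuotientCoeff m n)
    rw [← hKU]
    exact MeasurableSet.iUnion fun i => (hK i).isClosed.measurableSet
  have : numRealRoots η n ⁻¹' Set.Ici m = {ω | randomPoly η n ω = 0}ᶜ ∩
      (fun ω => fun k => (randomPoly η n ω).coeff k) ⁻¹' Set.range (rootsQuotientCoeff m n) := by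
    ext ω
    by_cases h0 : randomPoly η n ω = 0
    · simp [numRealRoots, h0]; omega
    · have := le_card_roots_iff h0 (m := m) (natDegree_randomPoly_le η n ω)
      simp only [Set.mem_preimage, Set.mem_Ici, Set.mem_inter_iff, Set.mem_compl_iff,
        Set.mem_ofPred_eq, h0, not_false_eq_true, true_and]
      exact this
  rw [this]
  exact hzero.compl.inter (hcoeff hrange)

lemma numRealRoots_le {Ω : Type*} (η : ℕ → Ω → ℝ) (n : ℕ) (ω : Ω) : numRealRoots η n ω ≤ n :=
  (card_roots' _).trans (natDegree_randomPoly_le η n ω)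

end Measurability

/-! ### Almost sure behaviour of the coefficients -/

section Coefficients

open scoped ENNReal

variable {Ω : Type*} [MeasurableSpace Ω] {P : Measure Ω} {η : ℕ → Ω → ℝ}

/-- If each event `η k ∈ B` has probability at most `ρ ^ L`, where `L ε ≥ 1`, then a set of at
least `ε n` indices lies in `B` altogether with probability at most `ρ ^ n`. -/
lemma measure_biInter_preimage_le (hindep : iIndepFun η P) {B : Set ℝ} (hB : MeasurableSet B)
    {ρ : ℝ≥0∞} (hρ : ρ ≤ 1) {L : ℕ} {ε : ℝ} (hL : 1 ≤ L * ε)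
    (hBρ : ∀ k, P (η k ⁻¹' B) ≤ ρ ^ L) {n : ℕ} {T : Finset ℕ} (hT : ε * n ≤ T.card) :
    P (⋂ k ∈ T, η k ⁻¹' B) ≤ ρ ^ n := by
  rw [hindep.measure_inter_preimage_eq_mul T (sets := fun _ => B) fun _ _ => hB]
  have hn : n ≤ L * T.card := by
    have : (n : ℝ) ≤ L * T.card := by
      calc (n : ℝ) ≤ L * ε * n := le_mul_of_one_le_left n.cast_nonneg hL
        _ = L * (ε * n) := by ring
        _ ≤ _ := by gcongr
    exact_mod_cast this
  calc ∏ k ∈ T, P (η k ⁻¹' B) ≤ ∏ _k ∈ T, ρ ^ L := Finset.prod_le_prod' fun k _ => hBρ k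
    _ = ρ ^ (L * T.card) := by rw [Finset.prod_const, pow_mul]
    _ ≤ ρ ^ n := pow_le_pow_right_of_le_one' hρ hn

lemma ae_eventually_notMem_of_le_geometric {E : ℕ → Set Ω} {c ρ : ℝ≥0∞} (hc : c ≠ ∞) (hρ : ρ < 1)
    (hE : ∀ n, P (E n) ≤ c * ρ ^ n) : ∀ᵐ ω ∂P, ∀ᶠ n in atTop, ω ∉ E n := by
  refine ae_eventually_notMem (ne_top_of_le_ne_top ?_ (ENNReal.tsum_le_tsum hE))
  rw [ENNReal.tsum_mul_left, ENNReal.tsum_geometric]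
  exact ENNReal.mul_ne_top hc (ENNReal.inv_ne_top.2 (tsub_pos_of_lt hρ).ne')

/-- Index sets of proportional size almost surely contain, from some point on, an index whose
coefficient avoids `B`. -/
lemma ae_eventually_exists_notMem (hindep : iIndepFun η P) {B : Set ℝ} (hB : MeasurableSet B)
    {ε : ℝ} (hε : 0 < ε) {q : ℝ≥0∞} (hq : q < 1) (hBq : ∀ k, P (η k ⁻¹' B) ≤ q)
    {T : ℕ → Finset ℕ} (hT : ∀ n, ε * n ≤ (T n).card) :
    ∀ᵐ ω ∂P, ∀ᶠ n in atTop, ∃ k ∈ T n, η k ω ∉ B := by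
  obtain ⟨L, hL⟩ := exists_nat_gt (1 / ε)
  have hL0 : (0 : ℝ) < L := (one_div_pos.2 hε).trans hL
  have hLε : 1 ≤ L * ε := by
    have := (div_lt_iff₀ hε).1 hL
    linarith
  have hρ : q ^ (1 / (L : ℝ)) < 1 := ENNReal.rpow_lt_one hq (by positivity)
  have hρL : (q ^ (1 / (L : ℝ))) ^ L = q := by
    rw [← ENNReal.rpow_natCast, ← ENNReal.rpow_mul, one_div, inv_mul_cancel₀ hL0.ne',
      ENNReal.rpow_one]
  have h := ae_eventually_notMem_of_le_geometric (P := P)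
    (E := fun n => ⋂ k ∈ T n, η k ⁻¹' B) ENNReal.one_ne_top hρ fun n => by
      rw [one_mul]
      exact measure_biInter_preimage_le hindep hB hρ.le hLε (fun k => by rw [hρL]; exact hBq k)
        (hT n)
  filter_upwards [h] with ω hω
  filter_upwards [hω] with n hn
  simpa using hn

open Classical in
/-- If the events `η k ∈ B` are improbable enough, then almost surely at most `ε n` of the first
`n + 1` of them occur, for large `n`: there are only `2 ^ (n + 1)` sets of indices to exclude. -/
lemma ae_eventually_card_filter_le (hindep : iIndepFun η P) {B : Set ℝ} (hB : MeasurableSet B)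
    {L : ℕ} {ε : ℝ} (hL : 1 ≤ L * ε) (hBL : ∀ k, P (η k ⁻¹' B) ≤ (4⁻¹ : ℝ≥0∞) ^ L) :
    ∀ᵐ ω ∂P, ∀ᶠ n : ℕ in atTop,
      (((Finset.range (n + 1)).filter fun k => η k ω ∈ B).card : ℝ) ≤ ε * n := by
  have h4 : (4⁻¹ : ℝ≥0∞) ≤ 1 := ENNReal.inv_le_one.2 (by norm_num)
  have h := ae_eventually_notMem_of_le_geometric (P := P) (c := 2) (ρ := 2⁻¹)
    (E := fun n => ⋃ T ∈ (Finset.range (n + 1)).powerset.filter (fun T => ε * n ≤ T.card),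
      ⋂ k ∈ T, η k ⁻¹' B) (by norm_num) (ENNReal.inv_lt_one.2 (by norm_num)) fun n => by
      refine (measure_biUnion_finset_le _ _).trans ?_
      have hle : ∀ T ∈ (Finset.range (n + 1)).powerset.filter (fun T => ε * n ≤ T.card),
          P (⋂ k ∈ T, η k ⁻¹' B) ≤ (4⁻¹ : ℝ≥0∞) ^ n := fun T hT =>
        measure_biInter_preimage_le hindep hB h4 hL hBL (Finset.mem_filter.1 hT).2
      refine (Finset.sum_le_card_nsmul _ _ _ hle).trans ?_
      have hcard : ((Finset.range (n + 1)).powerset.filter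
          (fun T : Finset ℕ => ε * n ≤ T.card)).card ≤ 2 ^ (n + 1) := by
        refine (Finset.card_filter_le _ _).trans_eq ?_
        rw [Finset.card_powerset, Finset.card_range]
      rw [nsmul_eq_mul]
      calc _ ≤ ((2 ^ (n + 1) : ℕ) : ℝ≥0∞) * (4⁻¹ : ℝ≥0∞) ^ n := by gcongr
        _ = 2 * (2 * 4⁻¹) ^ n := by push_cast; rw [pow_succ, mul_pow]; ring
        _ = 2 * 2⁻¹ ^ n := by
            congr 2
            rw [show (4 : ℝ≥0∞) = 2 * 2 by norm_num, ENNReal.mul_inv (by simp) (by simp),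
              ← mul_assoc, ENNReal.mul_inv_cancel (by simp) (by simp), one_mul]
  filter_upwards [h] with ω hω
  filter_upwards [hω] with n hn
  by_contra hlt
  refine hn (Set.mem_iUnion₂.2 ⟨(Finset.range (n + 1)).filter fun k => η k ω ∈ B, ?_, ?_⟩)
  · exact Finset.mem_filter.2 ⟨Finset.mem_powerset.2 (Finset.filter_subset _ _),
      (not_le.1 hlt).le⟩
  · simp

lemma eventually_measure_lt_abs_le (μ : Measure ℝ) [IsFiniteMeasure μ] {δ : ℝ≥0∞} (hδ : 0 < δ) :
    ∀ᶠ N : ℕ in atTop, μ {x | (N : ℝ) < |x|} ≤ δ := by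
  have h := tendsto_measure_iInter_atTop (μ := μ) (s := fun N : ℕ => {x : ℝ | (N : ℝ) < |x|})
    (fun N => (measurableSet_lt measurable_const measurable_norm).nullMeasurableSet)
    (fun M N hMN => Set.ofPred_subset_ofPred.2 fun x hx =>
      lt_of_le_of_lt (Nat.cast_le.2 hMN) hx) ⟨0, measure_ne_top _ _⟩
  have hempty : ⋂ N : ℕ, {x : ℝ | (N : ℝ) < |x|} = ∅ := by
    refine Set.eq_empty_iff_forall_notMem.2 fun x hx => ?_
    obtain ⟨N, hN⟩ := exists_nat_gt |x|
    exact lt_asymm hN (Set.mem_iInter.1 hx N)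
  rw [hempty, measure_empty] at h
  exact (h.eventually_lt_const hδ).mono fun N hN => hN.le

/-- A law other than the point mass at `0` gives probability less than `1` to small intervals
around `0`. -/
lemma eventually_measure_abs_lt_lt_one {μ : Measure ℝ} [IsProbabilityMeasure μ]
    (hμ : μ ≠ Measure.dirac 0) :
    ∀ᶠ N : ℕ in atTop, μ {x | |x| < 1 / ((N : ℝ) + 1)} < 1 := by
  have h := tendsto_measure_iInter_atTop (μ := μ)
    (s := fun N : ℕ => {x : ℝ | |x| < 1 / ((N : ℝ) + 1)})
    (fun N => (measurableSet_lt measurable_norm measurable_const).nullMeasurableSet)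
    (fun M N hMN => Set.ofPred_subset_ofPred.2 fun x hx =>
      lt_of_lt_of_le hx (Nat.one_div_le_one_div hMN)) ⟨0, measure_ne_top _ _⟩
  have hzero : ⋂ N : ℕ, {x : ℝ | |x| < 1 / ((N : ℝ) + 1)} = {0} := by
    ext x
    simp only [Set.mem_iInter, Set.mem_ofPred_eq, Set.mem_singleton_iff]
    refine ⟨fun hx => ?_, fun hx N => by rw [hx, abs_zero]; exact Nat.one_div_pos_of_nat⟩
    by_contra hne
    obtain ⟨N, hN⟩ := exists_nat_one_div_lt (abs_pos.2 hne)
    exact lt_asymm hN (hx N)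
  rw [hzero] at h
  refine h.eventually_lt_const (lt_of_le_of_ne prob_le_one fun h1 => hμ ?_)
  have hae : ∀ᵐ x ∂μ, x ∈ ({0} : Set ℝ) := (prob_compl_eq_zero_iff (measurableSet_singleton 0)).2 h1
  rw [← Measure.restrict_eq_self_of_ae_mem hae, Measure.restrict_singleton, h1, one_smul]

end Coefficients

/-! ### Real zeros of random polynomials -/

section RandomPolynomials

open scoped ENNReal

variable {Ω : Type*} [MeasurableSpace Ω] {P : Measure Ω} {r : ℕ}
  {ν : Fin r → Measure ℝ} {η : ℕ → Ω → ℝ}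

/-- A threshold `a > 0` such that almost surely, for every `ε`, both ends of the coefficient
sequence contain coefficients of modulus at least `a` within distance `ε n`, for large `n`. -/
lemma exists_ae_eventually_le_abs (hprob : ∀ i, IsProbabilityMeasure (ν i))
    (hne : ∀ i, ν i ≠ Measure.dirac 0) (hmeas : ∀ k, Measurable (η k)) (hindep : iIndepFun η P)
    (hlaw : ∀ k, ∃ i, P.map (η k) = ν i) :
    ∃ a : ℝ, 0 < a ∧ ∀ ε : ℝ, 0 < ε → ε ≤ 1 → ∀ᵐ ω ∂P, ∀ᶠ n : ℕ in atTop,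
      (∃ m ≤ n, (m : ℝ) ≤ ε * n ∧ a ≤ |η m ω|) ∧
      ∃ m ≤ n, (n : ℝ) - m ≤ ε * n ∧ a ≤ |η m ω| := by
  obtain ⟨N, hN⟩ := (eventually_all.2 fun i => eventually_measure_abs_lt_lt_one (hne i)).exists
  set a : ℝ := 1 / ((N : ℝ) + 1) with ha
  have hB : MeasurableSet {x : ℝ | |x| < a} := measurableSet_lt measurable_norm measurable_const
  set q : ℝ≥0∞ := Finset.univ.sup fun i => ν i {x | |x| < a} with hq
  have hq1 : q < 1 := (Finset.sup_lt_iff zero_lt_one).2 fun i _ => hN i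
  have hBq : ∀ k, P (η k ⁻¹' {x | |x| < a}) ≤ q := fun k => by
    obtain ⟨i, hi⟩ := hlaw k
    rw [← Measure.map_apply (hmeas k) hB, hi]
    exact Finset.le_sup (f := fun i => ν i {x | |x| < a}) (Finset.mem_univ i)
  refine ⟨a, Nat.one_div_pos_of_nat, fun ε hε hε1 => ?_⟩
  have hfloor : ∀ n : ℕ, ε * n ≤ (⌊ε * n⌋₊ + 1 : ℕ) := fun n => by
    push_cast
    exact (Nat.lt_floor_add_one _).le
  have hk : ∀ n k : ℕ, k ∈ Finset.range (⌊ε * n⌋₊ + 1) → (k : ℝ) ≤ ε * n ∧ k ≤ n := by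
    intro n k hk
    have h1 : (k : ℝ) ≤ ε * n :=
      (Nat.cast_le.2 (Finset.mem_range_succ_iff.1 hk)).trans (Nat.floor_le (by positivity))
    exact ⟨h1, Nat.cast_le (α := ℝ).1 (h1.trans (mul_le_of_le_one_left n.cast_nonneg hε1))⟩
  have hlow := ae_eventually_exists_notMem hindep hB hε hq1 hBq
    (T := fun n => Finset.range (⌊ε * n⌋₊ + 1)) fun n => by simpa using hfloor n
  have hhigh := ae_eventually_exists_notMem hindep hB hε hq1 hBq
    (T := fun n => (Finset.range (⌊ε * n⌋₊ + 1)).image (n - ·)) fun n => by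
      rw [Finset.card_image_of_injOn, Finset.card_range]
      · exact hfloor n
      · intro k hk1 l hl1 hkl
        have h1 := (hk n k hk1).2
        have h2 := (hk n l hl1).2
        have : n - k = n - l := hkl
        omega
  filter_upwards [hlow, hhigh] with ω h1 h2
  filter_upwards [h1, h2] with n ⟨m, hm, hma⟩ ⟨l, hl, hla⟩
  refine ⟨⟨m, (hk n m hm).2, (hk n m hm).1, not_lt.1 hma⟩, ?_⟩
  obtain ⟨k, hkT, rfl⟩ := Finset.mem_image.1 hl
  refine ⟨n - k, Nat.sub_le _ _, ?_, not_lt.1 hla⟩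
  rw [Nat.cast_sub (hk n k hkT).2]
  linarith [(hk n k hkT).1]

open Classical in
lemma exists_ae_eventually_card_lt_abs_le (hprob : ∀ i, IsProbabilityMeasure (ν i))
    (hmeas : ∀ k, Measurable (η k)) (hindep : iIndepFun η P)
    (hlaw : ∀ k, ∃ i, P.map (η k) = ν i) {ε : ℝ} (hε : 0 < ε) :
    ∃ A : ℝ, 0 < A ∧ ∀ᵐ ω ∂P, ∀ᶠ n : ℕ in atTop,
      (((Finset.range (n + 1)).filter fun k => A < |η k ω|).card : ℝ) ≤ ε * n := by
  obtain ⟨L, hL⟩ := exists_nat_gt (1 / ε)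
  have hδ : (0 : ℝ≥0∞) < (4⁻¹ : ℝ≥0∞) ^ L :=
    ENNReal.pow_pos (ENNReal.inv_pos.2 (by norm_num)) L
  obtain ⟨N, hN, hN0⟩ := ((eventually_all.2 fun i =>
    eventually_measure_lt_abs_le (ν i) hδ).and (eventually_gt_atTop 0)).exists
  have hB : MeasurableSet {x : ℝ | (N : ℝ) < |x|} :=
    measurableSet_lt measurable_const measurable_norm
  refine ⟨N, Nat.cast_pos.2 hN0, ?_⟩
  refine ae_eventually_card_filter_le hindep hB (L := L) ?_ fun k => ?_
  · exact ((div_lt_iff₀ hε).1 hL).le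
  · obtain ⟨i, hi⟩ := hlaw k
    rw [← Measure.map_apply (hmeas k) hB, hi]
    exact hN i

lemma ae_eventually_numRealRoots_le (hprob : ∀ i, IsProbabilityMeasure (ν i))
    (hne : ∀ i, ν i ≠ Measure.dirac 0) (hmeas : ∀ k, Measurable (η k)) (hindep : iIndepFun η P)
    (hlaw : ∀ k, ∃ i, P.map (η k) = ν i) {τ : ℝ} (h0 : 0 < τ) (h1 : τ ≤ 1) :
    ∀ᵐ ω ∂P, ∀ᶠ n : ℕ in atTop, (numRealRoots η n ω : ℝ) ≤ 80 * τ * n := by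
  classical
  obtain ⟨a, ha, hends⟩ := exists_ae_eventually_le_abs hprob hne hmeas hindep hlaw
  obtain ⟨A, hA, hlarge⟩ := exists_ae_eventually_card_lt_abs_le hprob hmeas hindep hlaw
    (pow_pos h0 4)
  filter_upwards [hends (τ ^ 4) (pow_pos h0 4) (pow_le_one₀ h0.le h1), hlarge] with ω hω1 hω2
  filter_upwards [hω1, hω2, eventually_card_roots_le h0 h1 hA ha]
    with n ⟨⟨m, hmn, hm, ham⟩, l, hln, hl, hal⟩ hbad hn
  refine hn (randomPoly η n ω) (natDegree_randomPoly_le η n ω) ?_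
    ⟨m, hmn, hm, by rwa [coeff_randomPoly, if_pos hmn]⟩
    ⟨l, hln, hl, by rwa [coeff_randomPoly, if_pos hln]⟩
  refine le_trans (Nat.cast_le.2 (Finset.card_le_card fun k hk => ?_)) hbad
  rw [Finset.mem_filter] at hk ⊢
  rwa [coeff_randomPoly, if_pos (Finset.mem_range_succ_iff.1 hk.1)] at hk

lemma ae_tendsto_numRealRoots_div (hprob : ∀ i, IsProbabilityMeasure (ν i))
    (hne : ∀ i, ν i ≠ Measure.dirac 0) (hmeas : ∀ k, Measurable (η k)) (hindep : iIndepFun η P)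
    (hlaw : ∀ k, ∃ i, P.map (η k) = ν i) :
    ∀ᵐ ω ∂P, Tendsto (fun n : ℕ => (numRealRoots η n ω : ℝ) / (n : ℝ)) atTop (𝓝 0) := by
  have hall := ae_all_iff.2 fun j : ℕ => ae_eventually_numRealRoots_le hprob hne hmeas hindep hlaw
    (τ := 1 / ((j : ℝ) + 1)) Nat.one_div_pos_of_nat
    (by rw [div_le_one (by positivity)]; linarith [j.cast_nonneg (α := ℝ)])
  filter_upwards [hall] with ω hω
  rw [tendsto_order]
  refine ⟨fun b hb => Eventually.of_forall fun n => hb.trans_le (by positivity), fun b hb => ?_⟩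
  obtain ⟨j, hj⟩ := exists_nat_one_div_lt (div_pos hb (by norm_num : (0 : ℝ) < 80))
  filter_upwards [hω j, eventually_gt_atTop 0] with n hn hn0
  have hn0' : (0 : ℝ) < n := Nat.cast_pos.2 hn0
  rw [div_lt_iff₀ hn0']
  refine hn.trans_lt (mul_lt_mul_of_pos_right ?_ hn0')
  linarith

end RandomPolynomials

theorem theorem5 {Ω : Type*} [MeasurableSpace Ω] (P : Measure Ω) [IsProbabilityMeasure P]
    (r : ℕ) (ν : Fin r → Measure ℝ) (hprob : ∀ i, IsProbabilityMeasure (ν i))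
    (hnondeg : ∀ i, NondegenerateLaw (ν i))
    (η : ℕ → Ω → ℝ) (hmeas : ∀ k, Measurable (η k)) (hindep : iIndepFun η P)
    (hlaw : ∀ k, ∃ i, P.map (η k) = ν i) :
    (∀ᵐ ω ∂P, (∀ᶠ n : ℕ in atTop, randomPoly η n ω ≠ 0) ∧
      Tendsto (fun n : ℕ => (numRealRoots η n ω : ℝ) / (n : ℝ)) atTop (𝓝 0)) ∧
    (∀ n : ℕ, Integrable (fun ω => (numRealRoots η n ω : ℝ)) P) ∧
    (fun n : ℕ => ∫ ω, (numRealRoots η n ω : ℝ) ∂P) =o[atTop] (fun n : ℕ => (n : ℝ)) := by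
  have hne : ∀ i, ν i ≠ Measure.dirac 0 := fun i => hnondeg i 0
  have hlim := ae_tendsto_numRealRoots_div hprob hne hmeas hindep hlaw
  have hM : ∀ n, Measurable fun ω => (numRealRoots η n ω : ℝ) := fun n =>
    measurable_from_top.comp (measurable_numRealRoots hmeas n)
  refine ⟨?_, fun n => ?_, ?_⟩
  · obtain ⟨a, ha, hends⟩ := exists_ae_eventually_le_abs hprob hne hmeas hindep hlaw
    filter_upwards [hends 1 one_pos le_rfl, hlim] with ω hω hlimω
    refine ⟨?_, hlimω⟩
    filter_upwards [hω] with n ⟨⟨m, hmn, _, ham⟩, _⟩ h0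
    have := coeff_randomPoly η n ω m
    rw [h0, if_pos hmn, Polynomial.coeff_zero] at this
    rw [← this, abs_zero] at ham
    exact ha.not_ge ham
  · refine Integrable.of_bound (hM n).aestronglyMeasurable n (Eventually.of_forall fun ω => ?_)
    rw [Real.norm_natCast]
    exact Nat.cast_le.2 (numRealRoots_le η n ω)
  · refine isLittleO_of_tendsto' ?_ ?_
    · filter_upwards [eventually_gt_atTop 0] with n hn h
      exact absurd h (Nat.cast_ne_zero.2 hn.ne')
    · have h := tendsto_integral_of_dominated_convergence (μ := P)
        (F := fun (n : ℕ) ω => (numRealRoots η n ω : ℝ) / n) (f := fun _ => 0) (fun _ => 1)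
        (fun n => ((hM n).div_const _).aestronglyMeasurable) (integrable_const _)
        (fun n => Eventually.of_forall fun ω => by
          rw [Real.norm_of_nonneg (by positivity)]
          exact div_le_one_of_le₀ (Nat.cast_le.2 (numRealRoots_le η n ω)) n.cast_nonneg) hlim
      simpa only [integral_div, integral_zero] using h
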